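/- For real numbers $x\ge 0$ and $y>0$ let $$g(x,y)=2\pi y\cdot \exp\Bigl(\frac{1}{3y}\Bigr)\cdot\Bigl(\frac{y}{e}\Bigr)^{y}\cdot\Bigl(1-\frac{x}{y^{2}}\Bigr)^{y},$$ and for positive integers $a$ define $f(a)$ recursively by $$f(1)=e,\qquad f(a+1)=f(a)+1+\frac{1}{2f(a)}+\frac{0.6}{2f(a)^{2}}\quad(a\ge 1).$$ Let $n\ge 2$ be an integer and write $[n]=\{1,\dots,n\}$. (1) Let $A$ be an $n\times n$ matrix with entries in $\{0,1\}$, and let $\rho$ be the number of zero entries of $A$. If every row sum and every column sum of $A$ is larger than $n-\sqrt{(n-2)/20}$, then the permanent of $A$ satisfies $$\frac{g(\rho,n)}{\sqrt{2\pi n}\;e^{2}}\;\le\;\mathrm{per}(A)\;\le\;19\cdot\frac{g(\rho,n)}{\sqrt{2\pi n}\;e^{2}}.$$ (2) Let $R_1,\dots,R_n\subseteq[n]$ satisfy $|R_i|\ge n-\sqrt{(n-2)/20}$ for every $i\in[n]$ and $|\{k\in[n]: j\in R_k\}|\ge n-\sqrt{(n-2)/20}$ for every $j\in[n]$. Let $\rho=n^2-\sum_{i\in[n]}|R_i|$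 and let $\Omega$ be the set of permutations $\sigma$ of $[n]$ with $\sigma(i)\in R_i$ for every $i\in[n]$. Then $$\frac{g(\rho,n)}{\sqrt{2\pi n}\;e^{2}}\;\le\;|\Omega|\;\le\;\prod_{i\in[n]}\frac{f(|R_i|)}{e}\;\le\;19\cdot\frac{g(\rho,n)}{\sqrt{2\pi n}\;e^{2}}.$$ -/

import Mathlib

noncomputable section

/-- `g(x, y) = 2πy · exp(1/(3y)) · (y/e)^y · (1 - x/y²)^y`, meant for `x ≥ 0` and `y > 0`. -/
def gEst (x y : ℝ) : ℝ :=
  2 * Real.pi * y * Real.exp (1 / (3 * y)) * (y / Real.exp 1) ^ y * (1 - x / y ^ 2) ^ y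

/-- The recursively defined sequence `f(1) = e`,
`f(a+1) = f(a) + 1 + 1/(2 f(a)) + 0.6/(2 f(a)²)` for `a ≥ 1`.
The value at `0` is a placeholder outside the domain. -/
def huberF : ℕ → ℝ
  | 0 => 0
  | 1 => Real.exp 1
  | a + 2 =>
    huberF (a + 1) + 1 + 1 / (2 * huberF (a + 1)) + 0.6 / (2 * huberF (a + 1) ^ 2)

/-- The number of zero entries of a matrix. -/
def zeroCount {n : ℕ} (A : Matrix (Fin n) (Fin n) ℝ) : ℕ :=
  Finset.card {p : Fin n × Fin n | A p.1 p.2 = 0}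

/-- The permutations `σ` of `[n]` lying in `R₁ × ⋯ × Rₙ`, that is, with `σ(i) ∈ Rᵢ` for all `i`. -/
def prpSolutions {n : ℕ} (R : Fin n → Finset (Fin n)) : Finset (Equiv.Perm (Fin n)) :=
  {σ | ∀ i, σ i ∈ R i}

end

/-!
*Upper bound.* Sum over the row `a` that is sent to a fixed column `b` and apply induction to the
minors. If `rᵢ` is the number of choices left to row `i` once column `b` is deleted and
`t = ∑ 1 / f(rᵢ)` over the rows meeting that column, the inequality `t e ≤ exp t` turns the
resulting sum of products into one product with factors `f(rᵢ) exp (1 / f(rᵢ)) / e`, and the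
recursion for `f` is made so that `f(r) exp (1 / f(r)) ≤ f(r + 1)`. Back in the full array,
`f(r) ≤ r + (log r) / 2 + 1.6`, the product of the `f(rᵢ) / e` exceeds `((n - ρ / n) / e) ^ n` by
at most a factor `exp ((log n) / 2 + 1.86)`, and `exp 3.86 ≤ 19 √(2 π)`.

*Lower bound.* Forbid the missing cells one at a time. Switching with a transposition shows that
the permutations through a cell `c` number at most `1 / n` times those that avoid only the forbidden
cells outside the row and column of `c`, so as in the lopsided local lemma each new cell costs a
factor of at most `1 - x`, where `x ≈ 1 / n`. Hence `(1 - x) ^ ρ n!` permutations remain, and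
Stirling's formula compares this number with `g`.
-/

section

open Finset Real

/-! ### The upper bound by the sequence `f` -/

lemma huberF_succ {a : ℕ} (ha : 1 ≤ a) :
    huberF (a + 1) = huberF a + 1 + 1 / (2 * huberF a) + 0.6 / (2 * huberF a ^ 2) := by
  obtain ⟨b, rfl⟩ := Nat.exists_eq_add_of_le' ha
  rfl

lemma add_le_huberF {a : ℕ} (ha : 1 ≤ a) : (a : ℝ) + 1.7 ≤ huberF a := by
  induction a, ha using Nat.le_induction with
  | base =>
    have := exp_one_gt_d9
    simp only [huberF, Nat.cast_one]
    linarith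
  | succ a ha ih =>
    have hpos : 0 < huberF a := lt_of_lt_of_le (by positivity) ih
    have h₁ : 0 < 1 / (2 * huberF a) := by positivity
    have h₂ : 0 < 0.6 / (2 * huberF a ^ 2) := by positivity
    rw [huberF_succ ha]
    push_cast
    linarith

lemma huberF_pos {a : ℕ} (ha : 1 ≤ a) : 0 < huberF a :=
  lt_of_lt_of_le (by positivity) (add_le_huberF ha)

lemma huberF_nonneg (a : ℕ) : 0 ≤ huberF a := by
  rcases Nat.eq_zero_or_pos a with rfl | ha
  · exact le_rfl
  · exact (huberF_pos ha).le

lemma huberF_le_succ (a : ℕ) : huberF a ≤ huberF (a + 1) := by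
  rcases Nat.eq_zero_or_pos a with rfl | ha
  · exact huberF_nonneg _
  · have := huberF_pos ha
    have h₁ : 0 < 1 / (2 * huberF a) := by positivity
    have h₂ : 0 < 0.6 / (2 * huberF a ^ 2) := by positivity
    rw [huberF_succ ha]
    linarith

lemma huberF_div_exp_one_nonneg (a : ℕ) : 0 ≤ huberF a / exp 1 :=
  div_nonneg (huberF_nonneg a) (exp_pos 1).le

lemma exp_le_cubic {x : ℝ} (hx₀ : 0 ≤ x) (hx₁ : x ≤ 1) :
    exp x ≤ 1 + x + x ^ 2 / 2 + 0.3 * x ^ 3 := by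
  have h := exp_bound' hx₀ hx₁ (n := 3) (by norm_num)
  norm_num [sum_range_succ, Nat.factorial] at h
  have : 0 ≤ x ^ 3 := by positivity
  linarith

/- The recursion for `huberF` is `t ↦ t (1 + x + x² / 2 + 0.3 x³)` with `x = 1 / t`: the first
Taylor terms of `t exp (1 / t)`, with `1 / 6` enlarged to `0.3` to absorb the remainder. -/
lemma huberF_mul_exp_le {a : ℕ} (ha : 1 ≤ a) :
    huberF a * exp (1 / huberF a) ≤ huberF (a + 1) := by
  have hpos := huberF_pos ha
  have hone : 1 ≤ huberF a := by
    have := add_le_huberF ha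
    have : (0 : ℝ) ≤ a := a.cast_nonneg
    linarith
  calc huberF a * exp (1 / huberF a)
      ≤ huberF a * (1 + 1 / huberF a + (1 / huberF a) ^ 2 / 2 + 0.3 * (1 / huberF a) ^ 3) := by
        gcongr
        exact exp_le_cubic (by positivity) ((div_le_one hpos).2 hone)
    _ = huberF (a + 1) := by
        rw [huberF_succ ha]
        field_simp
        ring

lemma sum_prod_erase_div_exp_one_le {ι : Type*} [DecidableEq ι] {s : Finset ι} {f : ι → ℝ}
    (hf : ∀ i ∈ s, 0 < f i) :
    ∑ a ∈ s, ∏ i ∈ s.erase a, f i / exp 1 ≤ ∏ i ∈ s, f i * exp (1 / f i) / exp 1 := by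
  have hterm : ∀ a ∈ s, ∏ i ∈ s.erase a, f i / exp 1
      = (∏ i ∈ s, f i / exp 1) * (exp 1 * (1 / f a)) := by
    intro a ha
    have := (hf a ha).ne'
    rw [← mul_prod_erase s _ ha]
    field_simp
  calc ∑ a ∈ s, ∏ i ∈ s.erase a, f i / exp 1
      = (∏ i ∈ s, f i / exp 1) * (exp 1 * ∑ a ∈ s, 1 / f a) := by
        rw [sum_congr rfl hterm, mul_sum, mul_sum]
    _ ≤ (∏ i ∈ s, f i / exp 1) * exp (∑ a ∈ s, 1 / f a) :=
        mul_le_mul_of_nonneg_left exp_one_mul_le_exp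
          (prod_nonneg fun i hi => div_nonneg (hf i hi).le (exp_pos 1).le)
    _ = ∏ i ∈ s, f i * exp (1 / f i) / exp 1 := by
        rw [exp_sum, ← prod_mul_distrib]
        exact prod_congr rfl fun i _ => by ring

lemma sum_prod_erase_huberF_le {ι : Type*} [DecidableEq ι] (s : Finset ι) (r : ι → ℕ) :
    ∑ a ∈ s, ∏ i ∈ s.erase a, huberF (r i) / exp 1 ≤ ∏ i ∈ s, huberF (r i + 1) / exp 1 := by
  by_cases hzero : ∃ a ∈ s, r a = 0
  · obtain ⟨a, has, ha⟩ := hzero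
    have hother : ∀ b ∈ s, b ≠ a → ∏ i ∈ s.erase b, huberF (r i) / exp 1 = 0 :=
      fun b _ hb => prod_eq_zero (mem_erase.2 ⟨hb.symm, has⟩) (by simp [ha, huberF])
    have hone : huberF (r a + 1) / exp 1 = 1 := by simp [ha, huberF]
    rw [sum_eq_single_of_mem a has hother, ← mul_prod_erase s _ has, hone, one_mul]
    gcongr with i
    · exact fun i _ => huberF_div_exp_one_nonneg _
    · exact huberF_le_succ _
  · push Not at hzero
    have hr : ∀ a ∈ s, 1 ≤ r a := fun a ha => Nat.one_le_iff_ne_zero.2 (hzero a ha)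
    refine (sum_prod_erase_div_exp_one_le fun a ha => huberF_pos (hr a ha)).trans ?_
    gcongr with i hi
    · exact fun i hi => div_nonneg (mul_pos (huberF_pos (hr i hi)) (exp_pos _)).le (exp_pos 1).le
    · exact huberF_mul_exp_le (hr i hi)

lemma sum_prod_huberF_card_erase_le {α β : Type*} [Fintype α] [DecidableEq α] [DecidableEq β]
    (R : α → Finset β) (b : β) :
    ∑ a with b ∈ R a, ∏ i ∈ univ.erase a, huberF #((R i).erase b) / exp 1
      ≤ ∏ i, huberF #(R i) / exp 1 := by
  set S : Finset α := {a | b ∈ R a}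
  have hmem {i : α} : i ∈ S ↔ b ∈ R i := by simp [S]
  have hsplit : ∀ a ∈ S, univ.erase a = (S.erase a).disjUnion Sᶜ
      (disjoint_compl_right.mono_left (erase_subset a S)) := by
    intro a ha
    ext i
    simp only [mem_erase, mem_univ, mem_disjUnion, mem_compl]
    grind
  have hin : ∀ i ∈ S, huberF (#((R i).erase b) + 1) / exp 1 = huberF #(R i) / exp 1 :=
    fun i hi => by rw [card_erase_add_one (hmem.1 hi)]
  have hout : ∀ i ∈ Sᶜ, huberF #((R i).erase b) / exp 1 = huberF #(R i) / exp 1 :=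
    fun i hi => by rw [erase_eq_of_notMem (mt hmem.2 (mem_compl.1 hi))]
  calc ∑ a ∈ S, ∏ i ∈ univ.erase a, huberF #((R i).erase b) / exp 1
      = (∑ a ∈ S, ∏ i ∈ S.erase a, huberF #((R i).erase b) / exp 1) *
          ∏ i ∈ Sᶜ, huberF #(R i) / exp 1 := by
        rw [sum_mul]
        exact sum_congr rfl fun a ha => by
          rw [hsplit a ha, prod_disjUnion, prod_congr rfl hout]
    _ ≤ (∏ i ∈ S, huberF (#((R i).erase b) + 1) / exp 1) * ∏ i ∈ Sᶜ, huberF #(R i) / exp 1 :=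
        mul_le_mul_of_nonneg_right (sum_prod_erase_huberF_le S _)
          (prod_nonneg fun _ _ => huberF_div_exp_one_nonneg _)
    _ = ∏ i, huberF #(R i) / exp 1 := by
        rw [prod_congr rfl hin, prod_mul_prod_compl]

section

variable {α β : Type*} [Fintype α] [DecidableEq α] [Fintype β] [DecidableEq β]

/-- The bijections `σ` with `σ i ∈ R i` for all `i`, that is, the bijective systems of
representatives of the family `R`. Allowing two different index types (where `prpSolutions` has
only one) is what makes deleting a row and a column, and hence induction, possible. -/
def choiceEquivs (R : α → Finset β) : Finset (α ≃ β) :=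
  {σ | ∀ i, σ i ∈ R i}

lemma mem_choiceEquivs {R : α → Finset β} {σ : α ≃ β} :
    σ ∈ choiceEquivs R ↔ ∀ i, σ i ∈ R i := by
  simp [choiceEquivs]

lemma card_filter_choiceEquivs_le (R : α → Finset β) (a : α) (b : β) :
    #{σ ∈ choiceEquivs R | σ.symm b = a}
      ≤ #(choiceEquivs fun i : {i // i ≠ a} => (R i).subtype (· ≠ b)) := by
  have hne (σ : α ≃ β) (hσ : σ.symm b = a) (i : α) : i ≠ a ↔ σ i ≠ b := by
    rw [← hσ, not_iff_not, Equiv.eq_symm_apply]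
  let restrict : ({σ ∈ choiceEquivs R | σ.symm b = a} : Finset (α ≃ β)) →
      choiceEquivs fun i : {i // i ≠ a} => (R i).subtype (· ≠ b) := fun σ =>
    ⟨σ.1.subtypeEquiv (hne σ.1 (mem_filter.1 σ.2).2), mem_choiceEquivs.2 fun i => by
      simpa using mem_choiceEquivs.1 (mem_filter.1 σ.2).1 i⟩
  refine card_le_card_of_injective (f := restrict) fun σ τ h => Subtype.ext (Equiv.ext fun i => ?_)
  by_cases hi : i = a
  · rw [hi, ← (Equiv.symm_apply_eq _).1 (mem_filter.1 σ.2).2,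
      ← (Equiv.symm_apply_eq _).1 (mem_filter.1 τ.2).2]
  · simpa [restrict] using congrArg (fun e => (e.1 ⟨i, hi⟩ : β)) h

lemma card_choiceEquivs_le_sum (R : α → Finset β) (b : β) :
    #(choiceEquivs R)
      ≤ ∑ a with b ∈ R a, #(choiceEquivs fun i : {i // i ≠ a} => (R i).subtype (· ≠ b)) := by
  have hmaps : ∀ σ ∈ choiceEquivs R, σ.symm b ∈ ({a | b ∈ R a} : Finset α) := fun σ hσ => by
    simpa using mem_choiceEquivs.1 hσ (σ.symm b)
  rw [card_eq_sum_card_fiberwise hmaps]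
  exact sum_le_sum fun a _ => card_filter_choiceEquivs_le R a b

theorem card_choiceEquivs_le_prod_huberF (R : α → Finset β) :
    (#(choiceEquivs R) : ℝ) ≤ ∏ i, huberF #(R i) / exp 1 := by
  induction hm : Fintype.card α generalizing α β with
  | zero =>
    have : IsEmpty α := Fintype.card_eq_zero_iff.1 hm
    rw [Fintype.prod_empty]
    exact_mod_cast card_le_one.2 fun σ _ τ _ => Equiv.ext fun a => isEmptyElim a
  | succ m ih =>
    rcases isEmpty_or_nonempty β with hβ | ⟨⟨b⟩⟩
    · have : Nonempty α := Fintype.card_pos_iff.1 (hm ▸ m.succ_pos)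
      have : IsEmpty (α ≃ β) := ⟨fun σ => isEmptyElim (σ (Classical.arbitrary α))⟩
      rw [eq_empty_of_isEmpty (choiceEquivs R), card_empty, Nat.cast_zero]
      exact prod_nonneg fun _ _ => huberF_div_exp_one_nonneg _
    have hminor (a : α) : (#(choiceEquivs fun i : {i // i ≠ a} => (R i).subtype (· ≠ b)) : ℝ)
        ≤ ∏ i ∈ univ.erase a, huberF #((R i).erase b) / exp 1 := by
      refine (ih _ ?_).trans_eq ?_
      · rw [Fintype.card_subtype_compl, Fintype.card_subtype_eq, hm, Nat.add_sub_cancel]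
      · rw [prod_subtype (p := (· ≠ a)) (univ.erase a) (by simp)]
        exact prod_congr rfl fun i _ => by rw [card_subtype, filter_ne']
    calc (#(choiceEquivs R) : ℝ)
        ≤ ∑ a with b ∈ R a,
            (#(choiceEquivs fun i : {i // i ≠ a} => (R i).subtype (· ≠ b)) : ℝ) :=
          mod_cast card_choiceEquivs_le_sum R b
      _ ≤ ∑ a with b ∈ R a, ∏ i ∈ univ.erase a, huberF #((R i).erase b) / exp 1 :=
          sum_le_sum fun a _ => hminor a
      _ ≤ ∏ i, huberF #(R i) / exp 1 := sum_prod_huberF_card_erase_le R b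

end

/-! ### The lower bound by switching -/

section

variable {α β : Type*} [Fintype α] [DecidableEq α] [Fintype β] [DecidableEq β]

/-- The bijections whose graph avoids the set `S` of cells, that is, `choiceEquivs` in terms of the
excluded cells, which can be varied one at a time. -/
def avoidingEquivs (S : Finset (α × β)) : Finset (α ≃ β) :=
  {σ | ∀ i, (i, σ i) ∉ S}

lemma mem_avoidingEquivs {S : Finset (α × β)} {σ : α ≃ β} :
    σ ∈ avoidingEquivs S ↔ ∀ i, (i, σ i) ∉ S := by
  simp [avoidingEquivs]

lemma card_avoidingEquivs_empty :
    #(avoidingEquivs (∅ : Finset (α × α))) = (Fintype.card α).factorial := by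
  simp [avoidingEquivs, ← Fintype.card_perm]

lemma card_avoidingEquivs_eq_insert_add (S : Finset (α × β)) (i : α) (j : β) :
    #(avoidingEquivs S)
      = #(avoidingEquivs (insert (i, j) S)) + #{σ ∈ avoidingEquivs S | σ i = j} := by
  have hinsert : avoidingEquivs (insert (i, j) S) = {σ ∈ avoidingEquivs S | ¬σ i = j} := by
    ext σ
    simp only [mem_avoidingEquivs, mem_filter, mem_insert, Prod.mk.injEq]
    grind
  rw [hinsert, add_comm, card_filter_add_card_filter_not]

/- Precomposing with the transposition of `i` and any `k` leaves the graph outside row `i` and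
column `j` disjoint from `S`, and the result determines `k` as the preimage of `j`. -/
lemma card_mul_card_filter_avoidingEquivs_le (S : Finset (α × β)) (i : α) (j : β) :
    Fintype.card α * #{σ ∈ avoidingEquivs S | σ i = j}
      ≤ #(avoidingEquivs {p ∈ S | p.1 ≠ i ∧ p.2 ≠ j}) := by
  rw [← card_univ, ← card_product]
  refine card_le_card_of_injOn (fun p => (Equiv.swap i p.1).trans p.2) ?_ ?_
  · rintro ⟨k, σ⟩ h
    obtain ⟨hσ, rfl⟩ := mem_filter.1 (mem_product.1 h).2
    refine mem_avoidingEquivs.2 fun l hl => ?_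
    obtain ⟨hlS, hli, hlj⟩ := mem_filter.1 hl
    simp only [Equiv.trans_apply] at hlS hlj
    have hlk : l ≠ k := by
      rintro rfl
      simp at hlj
    rw [Equiv.swap_apply_of_ne_of_ne hli hlk] at hlS
    exact mem_avoidingEquivs.1 hσ l hlS
  · rintro ⟨k, σ⟩ h ⟨l, τ⟩ h' heq
    have hσ : σ i = j := (mem_filter.1 (mem_product.1 h).2).2
    have hτ : τ i = j := (mem_filter.1 (mem_product.1 h').2).2
    simp only at heq
    have hk : ((Equiv.swap i k).trans σ) k = j := by simp [hσ]
    have hl : ((Equiv.swap i l).trans τ) l = j := by simp [hτ]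
    obtain rfl : k = l := ((Equiv.swap i k).trans σ).injective (hk.trans (heq ▸ hl).symm)
    have hστ : σ = τ := Equiv.ext fun m => by
      simpa using DFunLike.congr_fun heq (Equiv.swap i k m)
    rw [hστ]

/-- A set of cells with at most `D` cells in each row and in each column: the sparsity that
the local lemma argument needs. -/
structure LineBounded (S : Finset (α × β)) (D : ℕ) : Prop where
  row (i : α) : #{j | (i, j) ∈ S} ≤ D
  col (j : β) : #{i | (i, j) ∈ S} ≤ D

namespace LineBounded

variable {S T : Finset (α × β)} {D : ℕ}

lemma mono (hS : LineBounded S D) (hTS : T ⊆ S) : LineBounded T D where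
  row i := (card_le_card (monotone_filter_right _ fun _ _ h => hTS h)).trans (hS.row i)
  col j := (card_le_card (monotone_filter_right _ fun _ _ h => hTS h)).trans (hS.col j)

lemma card_sdiff_filter_le (hS : LineBounded S D) (i : α) (j : β) :
    #(S \ {p ∈ S | p.1 ≠ i ∧ p.2 ≠ j}) ≤ 2 * D := by
  have hcross : S \ {p ∈ S | p.1 ≠ i ∧ p.2 ≠ j} ⊆
      ({l | (i, l) ∈ S} : Finset β).image (Prod.mk i) ∪
        ({k | (k, j) ∈ S} : Finset α).image (Prod.mk · j) := by
    rintro ⟨k, l⟩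
    simp only [mem_sdiff, mem_filter, mem_union, mem_image, mem_univ, true_and, Prod.mk.injEq]
    grind
  calc #(S \ {p ∈ S | p.1 ≠ i ∧ p.2 ≠ j})
      ≤ #({l | (i, l) ∈ S} : Finset β) + #({k | (k, j) ∈ S} : Finset α) :=
        (card_le_card hcross).trans <|
          (card_union_le _ _).trans (add_le_add card_image_le card_image_le)
    _ ≤ 2 * D := by
        rw [two_mul]
        exact add_le_add (hS.row i) (hS.col j)

lemma card_le (hS : LineBounded S D) : #S ≤ Fintype.card α * D := by
  have hcard : #S = ∑ i, #{j | (i, j) ∈ S} := by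
    simp_rw [card_filter, ← Fintype.sum_prod_type' fun i j => if (i, j) ∈ S then 1 else 0]
    simp
  rw [hcard]
  simpa using sum_le_card_nsmul univ _ D fun i _ => hS.row i

end LineBounded

lemma one_sub_mul_card_avoidingEquivs_le {D : ℕ} {x : ℝ} (hx₀ : 0 ≤ x)
    (hx : 1 ≤ Fintype.card α * (x * (1 - x) ^ (2 * D))) {S : Finset (α × β)} {i : α} {j : β}
    (hS : (1 - x) ^ (2 * D) * #(avoidingEquivs {p ∈ S | p.1 ≠ i ∧ p.2 ≠ j})
      ≤ (#(avoidingEquivs S) : ℝ)) :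
    (1 - x) * #(avoidingEquivs S) ≤ (#(avoidingEquivs (insert (i, j) S)) : ℝ) := by
  set U := avoidingEquivs {p ∈ S | p.1 ≠ i ∧ p.2 ≠ j}
  set B : Finset (α ≃ β) := {σ ∈ avoidingEquivs S | σ i = j}
  have hn : (0 : ℝ) < Fintype.card α := mod_cast Fintype.card_pos_iff.2 ⟨i⟩
  have hB : (#B : ℝ) ≤ x * #(avoidingEquivs S) := by
    refine le_of_mul_le_mul_left ?_ hn
    calc (Fintype.card α : ℝ) * #B ≤ 1 * #U := by
          rw [one_mul]
          exact_mod_cast card_mul_card_filter_avoidingEquivs_le S i j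
      _ ≤ Fintype.card α * (x * (1 - x) ^ (2 * D)) * #U := by gcongr
      _ = Fintype.card α * (x * ((1 - x) ^ (2 * D) * #U)) := by ring
      _ ≤ Fintype.card α * (x * #(avoidingEquivs S)) := by gcongr
  have hsplit : (#(avoidingEquivs S) : ℝ) = #(avoidingEquivs (insert (i, j) S)) + #B :=
    mod_cast card_avoidingEquivs_eq_insert_add S i j
  linarith

theorem pow_mul_card_avoidingEquivs_le {D : ℕ} {x : ℝ} (hx₀ : 0 ≤ x) (hx₁ : x ≤ 1)
    (hx : 1 ≤ Fintype.card α * (x * (1 - x) ^ (2 * D))) {S : Finset (α × β)}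
    (hS : LineBounded S D) {T : Finset (α × β)} (hTS : T ⊆ S) :
    (1 - x) ^ #(S \ T) * #(avoidingEquivs T) ≤ (#(avoidingEquivs S) : ℝ) := by
  induction S using Finset.strongInduction generalizing T with
  | H S ih =>
    rcases hTS.eq_or_ssubset with rfl | hTS'
    · simp
    obtain ⟨⟨i, j⟩, heS, heT⟩ := exists_of_ssubset hTS'
    set S' := S.erase (i, j) with hS'
    have hS'S : S' ⊂ S := erase_ssubset heS
    have hS'D : LineBounded S' D := hS.mono hS'S.subset
    have hTS'' : T ⊆ S' := subset_erase.2 ⟨hTS, heT⟩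
    have hstep : (1 - x) * #(avoidingEquivs S') ≤ (#(avoidingEquivs S) : ℝ) := by
      rw [← insert_erase heS]
      refine one_sub_mul_card_avoidingEquivs_le hx₀ hx ?_
      refine le_trans ?_ (ih S' hS'S hS'D (filter_subset (fun p => p.1 ≠ i ∧ p.2 ≠ j) S'))
      gcongr 1
      exact pow_le_pow_of_le_one (by linarith) (by linarith) (hS'D.card_sdiff_filter_le i j)
    have hcard : #(S \ T) = #(S' \ T) + 1 := by
      rw [← card_erase_add_one (mem_sdiff.2 ⟨heS, heT⟩), hS', erase_sdiff_comm]
    calc (1 - x) ^ #(S \ T) * #(avoidingEquivs T)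
        = (1 - x) * ((1 - x) ^ #(S' \ T) * #(avoidingEquivs T)) := by
          rw [hcard]
          ring
      _ ≤ (1 - x) * #(avoidingEquivs S') :=
          mul_le_mul_of_nonneg_left (ih S' hS'S hS'D hTS'') (by linarith)
      _ ≤ #(avoidingEquivs S) := hstep

theorem pow_card_mul_factorial_le_card_avoidingEquivs {D : ℕ} {x : ℝ} (hx₀ : 0 ≤ x) (hx₁ : x ≤ 1)
    (hx : 1 ≤ Fintype.card α * (x * (1 - x) ^ (2 * D))) {S : Finset (α × α)}
    (hS : LineBounded S D) :
    (1 - x) ^ #S * (Fintype.card α).factorial ≤ (#(avoidingEquivs S) : ℝ) := by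
  simpa only [sdiff_empty, card_avoidingEquivs_empty] using
    pow_mul_card_avoidingEquivs_le hx₀ hx₁ hx hS (empty_subset S)

end

section

variable {α β : Type*} [Fintype α] [Fintype β] [DecidableEq β]

/-- The cells `(i, j)` with `j ∉ R i`: avoiding them is the same as choosing from `R`. -/
def forbiddenCells (R : α → Finset β) : Finset (α × β) :=
  {p | p.2 ∉ R p.1}

lemma mem_forbiddenCells {R : α → Finset β} {i : α} {j : β} :
    (i, j) ∈ forbiddenCells R ↔ j ∉ R i := by
  simp [forbiddenCells]

lemma avoidingEquivs_forbiddenCells [DecidableEq α] (R : α → Finset β) :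
    avoidingEquivs (forbiddenCells R) = choiceEquivs R := by
  ext σ
  simp [mem_avoidingEquivs, mem_choiceEquivs, mem_forbiddenCells]

lemma card_forbiddenCells (R : α → Finset β) :
    (#(forbiddenCells R) : ℝ) = Fintype.card α * Fintype.card β - ∑ i, (#(R i) : ℝ) := by
  have h : #(forbiddenCells R) = ∑ i, #(R i)ᶜ := by
    simp_rw [forbiddenCells, card_filter, Fintype.sum_prod_type, ← card_filter,
      compl_eq_univ_sdiff, sdiff_eq_filter]
  simp_rw [h, Nat.cast_sum, card_compl, Nat.cast_sub (card_le_univ _), sum_sub_distrib]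
  simp

lemma lineBounded_forbiddenCells [DecidableEq α] {R : α → Finset β} {D : ℕ}
    (hrow : ∀ i, Fintype.card β ≤ #(R i) + D)
    (hcol : ∀ j, Fintype.card α ≤ #{i | j ∈ R i} + D) :
    LineBounded (forbiddenCells R) D where
  row i := by
    simp_rw [mem_forbiddenCells, ← compl_filter, card_compl, filter_univ_mem]
    exact Nat.sub_le_iff_le_add'.2 (hrow i)
  col j := by
    simp_rw [mem_forbiddenCells, ← compl_filter, card_compl]
    exact Nat.sub_le_iff_le_add'.2 (hcol j)

end

/-! ### Comparison with `g` -/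

lemma gEst_div_sqrt_mul_exp_two (x y : ℝ) :
    gEst x y / (√(2 * π * y) * exp 2)
      = √(2 * π * y) * (y / exp 1) ^ y * (exp (1 / (3 * y)) * (1 - x / y ^ 2) ^ y / exp 2) := by
  calc gEst x y / (√(2 * π * y) * exp 2)
      = 2 * π * y / √(2 * π * y) * (y / exp 1) ^ y *
          (exp (1 / (3 * y)) * (1 - x / y ^ 2) ^ y / exp 2) := by
        rw [gEst]
        ring
    _ = _ := by rw [div_sqrt]

lemma le_sqrt_sub_two_div_twenty_iff {n d : ℝ} (hd : 0 ≤ d) (hn : 2 ≤ n) :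
    d ≤ √((n - 2) / 20) ↔ 20 * d ^ 2 + 2 ≤ n := by
  rw [le_sqrt hd (by linarith), le_div_iff₀ (by norm_num)]
  constructor <;> intro h <;> linarith

/- The increments beyond `1` are at most `1 / (2 (a + 1))`, so they add up to a logarithm; `1.6` is
what the initial value `huberF 2` requires. -/
lemma huberF_le_add_half_log {a : ℕ} (ha : 2 ≤ a) : huberF a ≤ a + (log a / 2 + 1.6) := by
  induction a, ha using Nat.le_induction with
  | base =>
    have he : 2.718 ≤ exp 1 := by linarith [exp_one_gt_d9]
    have h₁ : 1 / (2 * exp 1) ≤ 1 / (2 * 2.718) := by gcongr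
    have h₂ : 0.6 / (2 * exp 1 ^ 2) ≤ 0.6 / (2 * 2.718 ^ 2) := by gcongr
    have htwo : huberF 2 = exp 1 + 1 + 1 / (2 * exp 1) + 0.6 / (2 * exp 1 ^ 2) := rfl
    rw [htwo, Nat.cast_ofNat]
    norm_num at h₁ h₂ ⊢
    linarith [exp_one_lt_d9, log_two_gt_d9]
  | succ a ha ih =>
    have ha₁ : 1 ≤ a := one_le_two.trans ha
    have haR : (1 : ℝ) ≤ a := mod_cast ha₁
    have hf := add_le_huberF ha₁
    have hlog : log a + 1 / ((a : ℝ) + 1) ≤ log ((a : ℝ) + 1) := by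
      have h := one_sub_inv_le_log_of_pos (x := ((a : ℝ) + 1) / a) (by positivity)
      rw [log_div (by positivity) (by positivity), inv_div] at h
      have : 1 - (a : ℝ) / (a + 1) = 1 / (a + 1) := by
        field_simp
        ring
      linarith
    have hincr : 1 / (2 * huberF a) + 0.6 / (2 * huberF a ^ 2) ≤ 1 / ((a : ℝ) + 1) / 2 := by
      calc 1 / (2 * huberF a) + 0.6 / (2 * huberF a ^ 2)
          ≤ 1 / (2 * ((a : ℝ) + 1.7)) + 0.6 / (2 * ((a : ℝ) + 1.7) ^ 2) := by gcongr
        _ ≤ 1 / ((a : ℝ) + 1) / 2 := by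
            rw [div_add_div _ _ (by positivity) (by positivity), div_div,
              div_le_div_iff₀ (by positivity) (by positivity)]
            nlinarith
    rw [huberF_succ ha₁]
    push_cast
    linarith

lemma prod_le_pow_card_mul_exp {ι : Type*} (s : Finset ι) {f : ι → ℝ} (hf : ∀ i ∈ s, 0 ≤ f i)
    {m : ℝ} (hm : 0 < m) :
    ∏ i ∈ s, f i ≤ m ^ #s * exp ((∑ i ∈ s, f i) / m - #s) := by
  have hterm : ∀ i ∈ s, f i ≤ m * exp (f i / m - 1) := fun i _ => by
    have h := add_one_le_exp (f i / m - 1)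
    rwa [sub_add_cancel, div_le_iff₀' hm] at h
  refine (prod_le_prod hf hterm).trans_eq ?_
  rw [prod_mul_distrib, prod_const, ← exp_sum, sum_sub_distrib, sum_div]
  simp

lemma prod_huberF_div_exp_one_le {ι : Type*} (s : Finset ι) {r : ι → ℕ} {n : ℕ}
    (hr : ∀ i ∈ s, 2 ≤ r i) (hrn : ∀ i ∈ s, r i ≤ n) {m : ℝ} (hm : 0 < m)
    (hsum : ∑ i ∈ s, (r i : ℝ) = #s * m) :
    ∏ i ∈ s, huberF (r i) / exp 1 ≤ (m / exp 1) ^ #s * exp (#s * (log n / 2 + 1.6) / m) := by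
  set L : ℝ := log n / 2 + 1.6 with hL
  have hfactor : ∀ i ∈ s, huberF (r i) ≤ r i + L := by
    intro i hi
    have hpos : (0 : ℝ) < r i := mod_cast two_pos.trans_le (hr i hi)
    have hlog : log (r i) ≤ log n := log_le_log hpos (mod_cast hrn i hi)
    linarith [huberF_le_add_half_log (hr i hi)]
  calc ∏ i ∈ s, huberF (r i) / exp 1
      ≤ (m / exp 1) ^ #s * exp ((∑ i ∈ s, huberF (r i) / exp 1) / (m / exp 1) - #s) :=
        prod_le_pow_card_mul_exp s (fun i _ => huberF_div_exp_one_nonneg _) (by positivity)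
    _ ≤ (m / exp 1) ^ #s * exp ((∑ i ∈ s, ((r i : ℝ) + L) / exp 1) / (m / exp 1) - #s) := by
        gcongr with i hi
        exact hfactor i hi
    _ = (m / exp 1) ^ #s * exp (#s * L / m) := by
        rw [← sum_div, div_div_div_cancel_right₀ (exp_pos 1).ne', sum_add_distrib, hsum,
          sum_const, nsmul_eq_mul]
        congr 2
        field_simp
        ring

lemma mul_half_log_add_div_sub_le {n d : ℝ} (hd₀ : 0 ≤ d) (hd : 20 * d ^ 2 + 2 ≤ n) :
    n * (log n / 2 + 1.6) / (n - d) ≤ log n / 2 + 1.86 := by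
  have hn : 2 ≤ n := by nlinarith
  obtain ⟨u, hu₀, rfl⟩ : ∃ u, 0 < u ∧ u ^ 2 = n :=
    ⟨√n, sqrt_pos.2 (by linarith), sq_sqrt (by linarith)⟩
  have hlog : log (u ^ 2) / 2 ≤ u / 2 - 0.306 := by
    -- `log u` is compared with its tangent line at `2`.
    have h := log_le_sub_one_of_pos (half_pos hu₀)
    rw [log_div hu₀.ne' two_ne_zero] at h
    rw [log_pow]
    norm_num
    linarith [log_two_lt_d9]
  have hkey : d * (u / 2 + 1.554) ≤ 0.26 * u ^ 2 := by
    have hquartic : (u ^ 2 - 2) * (u / 2 + 1.554) ^ 2 ≤ 20 * (0.26 * u ^ 2) ^ 2 := by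
      nlinarith [sq_nonneg (u ^ 2 - 0.7 * u - 1.5)]
    have := mul_le_mul_of_nonneg_right hd (sq_nonneg (u / 2 + 1.554))
    refine le_of_sq_le_sq ?_ (by positivity)
    rw [mul_pow]
    linarith
  have hdn : 0 < u ^ 2 - d := by nlinarith
  have hdlog : d * (log (u ^ 2) / 2 + 1.86) ≤ d * (u / 2 + 1.554) :=
    mul_le_mul_of_nonneg_left (by linarith) hd₀
  rw [div_le_iff₀ hdn]
  linarith

lemma exp_le_nineteen_mul_sqrt_two_pi : exp 3.86 ≤ 19 * √(2 * π) := by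
  have he : exp 8 ≤ 2.7183 ^ 8 := by
    have : exp 8 = exp 1 ^ 8 := by rw [← exp_nat_mul]; norm_num
    rw [this]
    gcongr
    linarith [exp_one_lt_d9]
  have hquad : 1.3192 ≤ exp 0.28 :=
    le_trans (by norm_num) (quadratic_le_exp_of_nonneg (x := 0.28) (by norm_num))
  have hsplit : exp 3.86 ^ 2 * exp 0.28 = exp 8 := by
    rw [← exp_nat_mul, ← exp_add]
    norm_num
  have hsq : exp 3.86 ^ 2 * 1.3192 ≤ 2.7183 ^ 8 :=
    calc exp 3.86 ^ 2 * 1.3192 ≤ exp 3.86 ^ 2 * exp 0.28 := by gcongr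
      _ ≤ 2.7183 ^ 8 := hsplit.trans_le he
  refine le_of_sq_le_sq ?_ (by positivity)
  rw [mul_pow, sq_sqrt (by positivity)]
  norm_num at hsq ⊢
  linarith [pi_gt_d2]

lemma exp_half_log_add_le {n : ℝ} (hn : 0 < n) :
    exp (log n / 2 + 1.86) ≤ 19 * √(2 * π * n) / exp 2 := by
  rw [le_div_iff₀ (exp_pos 2), ← exp_add, add_assoc, show (1.86 : ℝ) + 2 = 3.86 by norm_num,
    exp_add, exp_half, exp_log hn, sqrt_mul (by positivity), ← mul_assoc, mul_comm]
  gcongr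
  exact exp_le_nineteen_mul_sqrt_two_pi

lemma exists_sum_eq_card_mul_sub {ι : Type*} [Fintype ι] [Nonempty ι] {f : ι → ℝ} {c s : ℝ}
    (hfc : ∀ i, f i ≤ c) (hf : ∀ i, c - s ≤ f i) :
    ∃ d, 0 ≤ d ∧ d ≤ s ∧ ∑ i, f i = Fintype.card ι * (c - d) := by
  have hcard : (0 : ℝ) < Fintype.card ι := mod_cast Fintype.card_pos
  have hupper : ∑ i, f i ≤ Fintype.card ι * c := by
    simpa using sum_le_card_nsmul univ f c fun i _ => hfc i
  have hlower : Fintype.card ι * (c - s) ≤ ∑ i, f i := by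
    simpa using card_nsmul_le_sum univ f (c - s) fun i _ => hf i
  refine ⟨c - (∑ i, f i) / Fintype.card ι, ?_, ?_, ?_⟩
  · rwa [sub_nonneg, div_le_iff₀' hcard]
  · rwa [sub_le_comm, le_div_iff₀' hcard]
  · rw [sub_sub_cancel, mul_div_cancel₀ _ hcard.ne']

theorem prod_huberF_le_gEst {n : ℕ} (hn : 2 ≤ n) {r : Fin n → ℕ} (hrn : ∀ i, r i ≤ n)
    (hr : ∀ i, (n : ℝ) - √(((n : ℝ) - 2) / 20) ≤ r i) :
    ∏ i, huberF (r i) / exp 1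
      ≤ 19 * (gEst ((n : ℝ) ^ 2 - ∑ i, (r i : ℝ)) n / (√(2 * π * n) * exp 2)) := by
  have hnR : (2 : ℝ) ≤ n := mod_cast hn
  have hn₀ : (0 : ℝ) < n := by linarith
  have : Nonempty (Fin n) := ⟨⟨0, by omega⟩⟩
  set s := √(((n : ℝ) - 2) / 20)
  have hs : 20 * s ^ 2 + 2 ≤ n :=
    (le_sqrt_sub_two_div_twenty_iff (sqrt_nonneg _) hnR).1 le_rfl
  obtain ⟨d, hd₀, hds, hsum⟩ :=
    exists_sum_eq_card_mul_sub (fun i => (Nat.cast_le (α := ℝ)).2 (hrn i)) hr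
  rw [Fintype.card_fin] at hsum
  have hr₂ (i : Fin n) : 2 ≤ r i := by
    have : (1 : ℝ) < r i := by nlinarith [hr i, sq_nonneg (s - 1 / 40)]
    exact_mod_cast this
  have hdn : 0 < n - d := by nlinarith
  have hbase : (n - d) / exp 1 = n / exp 1 * (1 - ((n : ℝ) ^ 2 - n * (n - d)) / n ^ 2) := by
    field_simp
    ring
  calc ∏ i, huberF (r i) / exp 1
      ≤ ((n - d) / exp 1) ^ n * exp (n * (log n / 2 + 1.6) / (n - d)) := by
        simpa using prod_huberF_div_exp_one_le univ (fun i _ => hr₂ i) (fun i _ => hrn i) hdn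
          (by simpa using hsum)
    _ ≤ ((n - d) / exp 1) ^ n * (19 * √(2 * π * n) / exp 2) := by
        gcongr
        refine le_trans (exp_le_exp.2 ?_) (exp_half_log_add_le hn₀)
        exact mul_half_log_add_div_sub_le hd₀ (le_trans (by gcongr) hs)
    _ ≤ ((n - d) / exp 1) ^ n * (19 * √(2 * π * n) / exp 2) * exp (1 / (3 * n)) :=
        le_mul_of_one_le_right (by positivity) (one_le_exp (by positivity))
    _ = _ := by
        rw [gEst_div_sqrt_mul_exp_two, rpow_natCast, rpow_natCast, hsum, hbase, mul_pow]
        ring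

/-- The local lemma parameter for forbidden sets with at most `D` cells in each of `n` rows and
columns: the main term `1 / n` is the probability of hitting one cell, and the correction
`4 D / n²` makes `1 ≤ n x (1 - x) ^ (2 * D)` hold. -/
noncomputable def cellWeight (n D : ℕ) : ℝ :=
  (1 + 4 * (D / n)) / n

lemma cellWeight_nonneg (n D : ℕ) : 0 ≤ cellWeight n D := by
  unfold cellWeight
  positivity

lemma bound_mul_cellWeight (n D : ℕ) : D * cellWeight n D = D / n * (1 + 4 * (D / n)) := by
  rw [cellWeight]
  ring

section

variable {n D : ℕ}

lemma natCast_div_le_one_tenth (hD : 20 * D ^ 2 + 2 ≤ n) : (D / n : ℝ) ≤ 1 / 10 := by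
  have hDn : 20 * (D : ℝ) ^ 2 + 2 ≤ n := mod_cast hD
  rw [div_le_iff₀ (by nlinarith)]
  nlinarith [sq_nonneg ((D : ℝ) - 1 / 4)]

lemma cellWeight_le (hD : 20 * D ^ 2 + 2 ≤ n) : cellWeight n D ≤ 0.7 := by
  have hn : (2 : ℝ) ≤ n := mod_cast (Nat.le_add_left _ _).trans hD
  rw [cellWeight, div_le_iff₀ (by linarith)]
  linarith [natCast_div_le_one_tenth hD]

lemma mul_cellWeight (hn : n ≠ 0) : n * cellWeight n D = 1 + 4 * (D / n) := by
  have : (n : ℝ) ≠ 0 := mod_cast hn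
  rw [cellWeight, mul_div_cancel₀ _ this]

lemma one_le_mul_cellWeight_mul_pow (hD : 20 * D ^ 2 + 2 ≤ n) :
    1 ≤ n * (cellWeight n D * (1 - cellWeight n D) ^ (2 * D)) := by
  have hn : n ≠ 0 := by omega
  have hnx := mul_cellWeight (D := D) hn
  have hx₀ := cellWeight_nonneg n D
  have ht := natCast_div_le_one_tenth hD
  have hDx := bound_mul_cellWeight n D
  set x := cellWeight n D
  set t : ℝ := D / n
  have ht₀ : 0 ≤ t := by positivity
  have hbernoulli : 1 + 2 * D * -x ≤ (1 - x) ^ (2 * D) := by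
    simpa [sub_eq_add_neg] using
      one_add_mul_le_pow (a := -x) (by linarith [cellWeight_le hD]) (2 * D)
  calc (1 : ℝ) ≤ (1 + 4 * t) * (1 - 2 * (t * (1 + 4 * t))) := by
        nlinarith [mul_nonneg ht₀ ht₀, mul_nonneg ht₀ (sub_nonneg.2 ht),
          mul_nonneg (mul_nonneg ht₀ ht₀) (sub_nonneg.2 ht)]
    _ = n * x * (1 + 2 * D * -x) := by
        rw [hnx, ← hDx]
        ring
    _ ≤ n * x * (1 - x) ^ (2 * D) := by gcongr
    _ = n * (x * (1 - x) ^ (2 * D)) := by ring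

lemma mul_cellWeight_div_one_sub_le (hD : 20 * D ^ 2 + 2 ≤ n) {k : ℝ} (hk : k ≤ n * D) :
    k * (cellWeight n D / (1 - cellWeight n D)) ≤ k / n + 1.2 := by
  have hn : n ≠ 0 := by omega
  have hn₀ : (0 : ℝ) < n := mod_cast Nat.pos_of_ne_zero hn
  have hDn : 20 * (D : ℝ) ^ 2 + 2 ≤ n := mod_cast hD
  have hnx := mul_cellWeight (D := D) hn
  have hx₀ := cellWeight_nonneg n D
  have hx := cellWeight_le hD
  have ht := natCast_div_le_one_tenth hD
  have hDt : D * (D / n : ℝ) ≤ 1 / 20 := by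
    rw [← mul_div_assoc, div_le_iff₀ hn₀]
    linarith
  have hDx := bound_mul_cellWeight n D
  set x := cellWeight n D
  set t : ℝ := D / n
  have : 0 ≤ t := by positivity
  have hexcess : k / n * (4 * t + x) ≤ 1.2 * (1 - x) := by
    calc k / n * (4 * t + x) ≤ D * (4 * t + x) := by
          gcongr
          exact (div_le_iff₀' hn₀).2 hk
      _ = 4 * (D * t) + t * (1 + 4 * t) := by
          rw [← hDx]
          ring
      _ ≤ 1.2 * (1 - x) := by nlinarith
  rw [← mul_div_assoc, div_le_iff₀ (by linarith)]
  calc k * x = k / n * (n * x) := by field_simp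
    _ = k / n * (1 - x) + k / n * (4 * t + x) := by
        rw [hnx]
        ring
    _ ≤ (k / n + 1.2) * (1 - x) := by linarith

lemma exp_mul_one_sub_div_sq_pow_le (hD : 20 * D ^ 2 + 2 ≤ n) {k : ℕ} (hk : k ≤ n * D) :
    exp (1 / (3 * n)) * (1 - (k : ℝ) / n ^ 2) ^ n / exp 2 ≤ (1 - cellWeight n D) ^ k := by
  have hn : (2 : ℝ) ≤ n := mod_cast (Nat.le_add_left _ _).trans hD
  have hkR : (k : ℝ) ≤ n * D := mod_cast hk
  have hexponent := mul_cellWeight_div_one_sub_le hD hkR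
  have hkn : (k : ℝ) / n ≤ n := by
    rw [div_le_iff₀ (by linarith)]
    have hDn : D ≤ n := by nlinarith
    exact_mod_cast hk.trans (Nat.mul_le_mul_left n hDn)
  have hthird : 1 / (3 * (n : ℝ)) ≤ 1 / (3 * 2) := by gcongr
  have hx : 0 < 1 - cellWeight n D := by linarith [cellWeight_le hD]
  set x := cellWeight n D
  have hlog : -(x / (1 - x)) ≤ log (1 - x) := by
    refine le_trans (le_of_eq ?_) (one_sub_inv_le_log_of_pos hx)
    field_simp
    ring
  calc exp (1 / (3 * n)) * (1 - (k : ℝ) / n ^ 2) ^ n / exp 2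
      ≤ exp (1 / (3 * n)) * exp (-(k / n)) / exp 2 := by
        rw [sq, ← div_div (k : ℝ)]
        gcongr
        exact one_sub_div_pow_le_exp_neg hkn
    _ = exp (1 / (3 * n) + -(k / n) - 2) := by rw [exp_sub, exp_add]
    _ ≤ exp (k * log (1 - x)) := by
        gcongr
        nlinarith [mul_le_mul_of_nonneg_left hlog (Nat.cast_nonneg (α := ℝ) k)]
    _ = (1 - x) ^ k := by rw [exp_nat_mul, exp_log hx]

end

theorem gEst_div_le_card_avoidingEquivs {α : Type*} [Fintype α] [DecidableEq α]
    {S : Finset (α × α)} {D : ℕ} (hD : 20 * D ^ 2 + 2 ≤ Fintype.card α) (hS : LineBounded S D) :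
    gEst #S (Fintype.card α) / (√(2 * π * Fintype.card α) * exp 2) ≤ #(avoidingEquivs S) := by
  set n := Fintype.card α
  have hx₁ : cellWeight n D ≤ 1 := by linarith [cellWeight_le hD]
  calc gEst #S n / (√(2 * π * n) * exp 2)
      = √(2 * π * n) * (n / exp 1) ^ n *
          (exp (1 / (3 * n)) * (1 - (#S : ℝ) / n ^ 2) ^ n / exp 2) := by
        rw [gEst_div_sqrt_mul_exp_two, rpow_natCast, rpow_natCast]
    _ ≤ √(2 * π * n) * (n / exp 1) ^ n * (1 - cellWeight n D) ^ #S := by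
        gcongr
        exact exp_mul_one_sub_div_sq_pow_le hD hS.card_le
    _ ≤ (1 - cellWeight n D) ^ #S * n.factorial := by
        rw [mul_comm]
        gcongr
        exact Stirling.le_factorial_stirling n
    _ ≤ #(avoidingEquivs S) := pow_card_mul_factorial_le_card_avoidingEquivs
        (cellWeight_nonneg n D) hx₁ (one_le_mul_cellWeight_mul_pow hD) hS

/-! ### Permutations and 0/1 matrices -/

lemma le_add_floor_of_sub_le {n m : ℕ} {s : ℝ} (h : (n : ℝ) - s ≤ m) : n ≤ m + ⌊s⌋₊ := by
  have : (n : ℝ) < m + ⌊s⌋₊ + 1 := by linarith [Nat.lt_floor_add_one s]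
  exact Nat.lt_add_one_iff.1 (mod_cast this)

lemma prpSolutions_eq_choiceEquivs {n : ℕ} (R : Fin n → Finset (Fin n)) :
    prpSolutions R = choiceEquivs R := by
  ext σ
  simp [prpSolutions, mem_choiceEquivs]

section

variable {n : ℕ} {R : Fin n → Finset (Fin n)}

theorem gEst_le_card_prpSolutions (hn : 2 ≤ n)
    (hrow : ∀ i, (n : ℝ) - √(((n : ℝ) - 2) / 20) ≤ #(R i))
    (hcol : ∀ j, (n : ℝ) - √(((n : ℝ) - 2) / 20) ≤ #{k | j ∈ R k}) :
    gEst ((n : ℝ) ^ 2 - ∑ i, (#(R i) : ℝ)) n / (√(2 * π * n) * exp 2) ≤ #(prpSolutions R) := by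
  set s := √(((n : ℝ) - 2) / 20)
  have hD : 20 * ⌊s⌋₊ ^ 2 + 2 ≤ Fintype.card (Fin n) := by
    rw [Fintype.card_fin]
    exact_mod_cast (le_sqrt_sub_two_div_twenty_iff (Nat.cast_nonneg ⌊s⌋₊) (mod_cast hn)).1
      (Nat.floor_le (sqrt_nonneg _))
  have hS : LineBounded (forbiddenCells R) ⌊s⌋₊ := by
    refine lineBounded_forbiddenCells ?_ ?_ <;> rw [Fintype.card_fin]
    · exact fun i => le_add_floor_of_sub_le (hrow i)
    · exact fun j => le_add_floor_of_sub_le (hcol j)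
  simpa only [card_forbiddenCells, Fintype.card_fin, ← sq, avoidingEquivs_forbiddenCells,
    prpSolutions_eq_choiceEquivs] using gEst_div_le_card_avoidingEquivs hD hS

theorem prpSolutions_bounds (hn : 2 ≤ n)
    (hrow : ∀ i, (n : ℝ) - √(((n : ℝ) - 2) / 20) ≤ #(R i))
    (hcol : ∀ j, (n : ℝ) - √(((n : ℝ) - 2) / 20) ≤ #{k | j ∈ R k}) :
    gEst ((n : ℝ) ^ 2 - ∑ i, (#(R i) : ℝ)) n / (√(2 * π * n) * exp 2) ≤ #(prpSolutions R) ∧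
      #(prpSolutions R) ≤ ∏ i, huberF #(R i) / exp 1 ∧
      ∏ i, huberF #(R i) / exp 1
        ≤ 19 * (gEst ((n : ℝ) ^ 2 - ∑ i, (#(R i) : ℝ)) n / (√(2 * π * n) * exp 2)) :=
  ⟨gEst_le_card_prpSolutions hn hrow hcol,
    prpSolutions_eq_choiceEquivs R ▸ card_choiceEquivs_le_prod_huberF R,
    prod_huberF_le_gEst hn (fun i => card_finset_fin_le (R i)) hrow⟩

end

section

variable {α β : Type*} [DecidableEq β]

/-- The `0/1` matrix whose `i`-th row is the indicator function of `R i`; it turns statements about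
permanents into statements about `choiceEquivs R`. -/
def indicatorMatrix (R : α → Finset β) : Matrix α β ℝ :=
  Matrix.of fun i j => if j ∈ R i then 1 else 0

lemma indicatorMatrix_apply (R : α → Finset β) (i : α) (j : β) :
    indicatorMatrix R i j = if j ∈ R i then 1 else 0 :=
  rfl

lemma exists_indicatorMatrix_eq [Finite β] {A : Matrix α β ℝ}
    (hA : ∀ i j, A i j = 0 ∨ A i j = 1) : ∃ R, indicatorMatrix R = A := by
  have := Fintype.ofFinite β
  refine ⟨fun i => {j | A i j = 1}, ?_⟩
  ext i j
  rcases hA i j with h | h <;> simp [indicatorMatrix_apply, h]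

lemma sum_indicatorMatrix_row [Fintype β] (R : α → Finset β) (i : α) :
    ∑ j, indicatorMatrix R i j = #(R i) := by
  simp [indicatorMatrix_apply]

lemma sum_indicatorMatrix_col [Fintype α] (R : α → Finset β) (j : β) :
    ∑ i, indicatorMatrix R i j = #{k | j ∈ R k} := by
  simp [indicatorMatrix_apply]

lemma permanent_indicatorMatrix [Fintype β] (R : β → Finset β) :
    (indicatorMatrix R).permanent = #(choiceEquivs R) := by
  rw [← Matrix.permanent_transpose, Matrix.permanent]
  simp [indicatorMatrix_apply, prod_boole, choiceEquivs]

end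

lemma zeroCount_indicatorMatrix {n : ℕ} (R : Fin n → Finset (Fin n)) :
    (zeroCount (indicatorMatrix R) : ℝ) = (n : ℝ) ^ 2 - ∑ i, (#(R i) : ℝ) := by
  have : zeroCount (indicatorMatrix R) = #(forbiddenCells R) := by
    simp [zeroCount, indicatorMatrix_apply, forbiddenCells]
  rw [this, card_forbiddenCells, Fintype.card_fin, sq]

end

theorem mainTheorem1 (n : ℕ) (hn : 2 ≤ n) :
    (∀ A : Matrix (Fin n) (Fin n) ℝ,
      (∀ i j, A i j = 0 ∨ A i j = 1) →
      (∀ i, (n : ℝ) - Real.sqrt (((n : ℝ) - 2) / 20) < ∑ j, A i j) →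
      (∀ j, (n : ℝ) - Real.sqrt (((n : ℝ) - 2) / 20) < ∑ i, A i j) →
      gEst (zeroCount A : ℝ) (n : ℝ) / (Real.sqrt (2 * Real.pi * n) * Real.exp 2)
          ≤ A.permanent ∧
        A.permanent ≤
          19 * (gEst (zeroCount A : ℝ) (n : ℝ) / (Real.sqrt (2 * Real.pi * n) * Real.exp 2))) ∧
    (∀ R : Fin n → Finset (Fin n),
      (∀ i, (n : ℝ) - Real.sqrt (((n : ℝ) - 2) / 20) ≤ ((R i).card : ℝ)) →
      (∀ j, (n : ℝ) - Real.sqrt (((n : ℝ) - 2) / 20)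
        ≤ ((Finset.card {k : Fin n | j ∈ R k} : ℕ) : ℝ)) →
      ∀ ρ : ℝ, ρ = (n : ℝ) ^ 2 - ∑ i, ((R i).card : ℝ) →
      gEst ρ (n : ℝ) / (Real.sqrt (2 * Real.pi * n) * Real.exp 2)
          ≤ ((prpSolutions R).card : ℝ) ∧
        ((prpSolutions R).card : ℝ) ≤ ∏ i, (huberF (R i).card / Real.exp 1) ∧
        ∏ i, (huberF (R i).card / Real.exp 1)
          ≤ 19 * (gEst ρ (n : ℝ) / (Real.sqrt (2 * Real.pi * n) * Real.exp 2))) := by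
  refine ⟨fun A hA hrow hcol => ?_, fun R hrow hcol ρ hρ => ?_⟩
  · obtain ⟨R, rfl⟩ := exists_indicatorMatrix_eq hA
    simp only [sum_indicatorMatrix_row, sum_indicatorMatrix_col] at hrow hcol
    obtain ⟨hlower, hmiddle, hupper⟩ :=
      prpSolutions_bounds hn (fun i => (hrow i).le) (fun j => (hcol j).le)
    rw [permanent_indicatorMatrix, ← prpSolutions_eq_choiceEquivs, zeroCount_indicatorMatrix]
    exact ⟨hlower, hmiddle.trans hupper⟩
  · subst hρ
    exact prpSolutions_bounds hn hrow hcol
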